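/- A $[k,n,1]$-graph is a $k$-partite graph with parts $V_1,\dots,V_k$ of exactly $n$ vertices each such that, for any two distinct parts, the bipartite graph induced by them is a (not necessarily perfect) matching, i.e. every vertex of one part has at most one neighbour in the other. An independent transversal is an independent set of vertices containing exactly one vertex of each part, and a factor of independent transversals is a set of pairwise disjoint independent transversals covering all vertices. For $n \ge 1$ let $g(n)$ denote the largest integer $k$ such that every $[k,n,1]$-graph has a factor of independent transversals. Then, for all sufficiently large $n$, this largest integer exists and $g(n) \ge 0.562\,n$. -/

import Mathlib

/-- `G`, with parts the colour classes `V₀, …, V_{k-1}` of the proper colouring `P` (so no edge lies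
inside a part), is a `[k,n,1]`-graph: every part has exactly `n` vertices, and the bipartite graph
induced by any two distinct parts is a (not necessarily perfect) matching, that is, every vertex of
one of them has at most one neighbour in the other. -/
structure IsKN1Graph {V : Type*} {k : ℕ} (G : SimpleGraph V) (P : G.Coloring (Fin k)) (n : ℕ) :
    Prop where
  encard_part : ∀ i : Fin k, (P.colorClass i).encard = (n : ℕ∞)
  matching : ∀ i j : Fin k, i ≠ j → ∀ v ∈ P.colorClass i,
    ∀ w ∈ P.colorClass j, ∀ w' ∈ P.colorClass j, G.Adj v w → G.Adj v w' → w = w'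

/-- A transversal: a set of vertices containing exactly one vertex of each part. -/
def IsTransversal {V : Type*} {k : ℕ} {G : SimpleGraph V} (P : G.Coloring (Fin k)) (S : Set V) :
    Prop :=
  ∀ i : Fin k, ∃! v, v ∈ S ∧ v ∈ P.colorClass i

/-- A transversal that is an independent set of the graph. -/
def IsIndepTransversal {V : Type*} {k : ℕ} {G : SimpleGraph V} (P : G.Coloring (Fin k))
    (S : Set V) : Prop :=
  IsTransversal P S ∧ G.IsIndepSet S

/-- A factor of independent transversals: a set of pairwise disjoint independent transversals
that together cover all vertices. -/
structure IsIndepTransversalFactor {V : Type*} {k : ℕ} {G : SimpleGraph V}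
    (P : G.Coloring (Fin k)) (F : Set (Set V)) : Prop where
  indepTransversal : ∀ S ∈ F, IsIndepTransversal P S
  pairwiseDisjoint : ∀ S ∈ F, ∀ T ∈ F, S ≠ T → Disjoint S T
  cover : ⋃₀ F = Set.univ

/-- Every `[k,n,1]`-graph has a factor of independent transversals. -/
def EveryKN1GraphHasFactor (k n : ℕ) : Prop :=
  ∀ (V : Type) (G : SimpleGraph V) (P : G.Coloring (Fin k)),
    IsKN1Graph G P n → ∃ F : Set (Set V), IsIndepTransversalFactor P F

/-- The largest `k` such that every `[k,n,1]`-graph has a factor of independent transversals. -/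
noncomputable def gMax (n : ℕ) : ℕ :=
  sSup {k : ℕ | EveryKN1GraphHasFactor k n}

/-! Label each part bijectively by `Fin n`; the vertices labelled `T` form a transversal, and all
`n` of them form a factor of independent transversals when no edge has equal labels at its ends.
Parts are labelled one at a time. When `m` parts are done, each vertex of the next part has at most
`m` forbidden labels and each label is forbidden to at most `m` vertices, so Hall's theorem alone
reaches about `n/2` parts.

To pass `n/2`, keep codegrees small, a codegree being the number of labels forbidden to both of two
vertices of one part. If every codegree is at most `c` and `c + m ≤ n`, Hall's condition still holds
(`exists_perm_of_inter_le`). For `m < 0.485 n` the allowed bipartite graph has a spanning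
`r`-regular subgraph, with `r = R - m` and `R ≈ 0.829 n`. By Birkhoff, a random perfect matching of
it uses each edge with probability at most `1/r`. A pair of codegree `c` then gains at most `2(m -
c)/r` on average, which leads to the trajectory `c ≈ m²/R`.

The random choice is made deterministic by an exponential potential over all pairs
(`exists_potential_step`), which keeps every codegree within `0.0001 n` of the trajectory. From
`0.485 n` to `0.562 n` parts any valid labelling serves, since codegrees grow by at most 2 per part.
-/

/-! ### Regular bipartite subgraphs and Hall-type matchings -/

open Finset in
/-- A bipartite degree-constrained subgraph: if every pair of vertex sets spans enough allowed
pairs, each left vertex can be given `r` distinct allowed right vertices so that every right vertex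
is used at most `r` times. -/
theorem exists_regular_selection {n r : ℕ} (C : Fin n → Fin n → Prop) [DecidableRel C]
    (hC : ∀ A B : Finset (Fin n), r * #A + r * #B ≤
      #{p : Fin n × Fin n | C p.1 p.2 ∧ p.1 ∈ A ∧ p.2 ∈ B} + r * n) :
    ∃ g : Fin n → Fin r → Fin n, (∀ x i, C x (g x i)) ∧ (∀ x, Function.Injective (g x)) ∧
      ∀ y, #{p : Fin n × Fin r | g p.1 p.2 = y} ≤ r := by
  classical
  let E := {p : Fin n × Fin n // C p.1 p.2}
  -- Each left copy `(x, i)` claims an edge at `x`. Each edge claims either itself or one of the `r`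
  -- slots of its right end. An edge claimed by a copy is thus forced into a slot, which bounds the
  -- use of every right vertex by `r`.
  let t : (Fin n × Fin r) ⊕ E → Finset (E ⊕ (Fin n × Fin r)) := fun z => match z with
    | Sum.inl p => (univ.filter fun e : E => e.1.1 = p.1).disjSum ∅
    | Sum.inr e => ({e} : Finset E).disjSum (univ.filter fun q : Fin n × Fin r => q.1 = e.1.2)
  have hall : ∀ s : Finset ((Fin n × Fin r) ⊕ E), #s ≤ #(s.biUnion t) := by
    intro s
    let A : Finset (Fin n) := s.toLeft.image Prod.fst
    let Y : Finset (Fin n) := s.toRight.image fun e => e.1.2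
    let D : Finset E := univ.filter fun e => e.1.1 ∈ A ∧ e.1.2 ∈ Yᶜ
    have h1 : #s.toLeft ≤ r * #A := by
      have : s.toLeft ⊆ A ×ˢ univ := fun p hp => by
        simp only [mem_product, mem_univ, and_true]; exact mem_image_of_mem _ hp
      simpa [mul_comm] using card_le_card this
    have hdisj : Disjoint s.toRight D := by
      rw [disjoint_left]
      intro e he hD
      exact (mem_compl.1 (mem_filter.1 hD).2.2) (mem_image_of_mem _ he)
    have h2 : (s.toRight ∪ D).disjSum (Y ×ˢ (univ : Finset (Fin r))) ⊆ s.biUnion t := by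
      intro z hz
      rw [mem_biUnion]
      rcases mem_disjSum.1 hz with ⟨e, he, rfl⟩ | ⟨q, hq, rfl⟩
      · rcases mem_union.1 he with he | he
        · exact ⟨Sum.inr e, mem_toRight.1 he, by simp [t]⟩
        · obtain ⟨p, hp, hpe⟩ := mem_image.1 (mem_filter.1 he).2.1
          exact ⟨Sum.inl p, mem_toLeft.1 hp, by simp [t, hpe]⟩
      · obtain ⟨e, he, hqe⟩ := mem_image.1 (mem_product.1 hq).1
        exact ⟨Sum.inr e, mem_toRight.1 he, by simp [t, hqe]⟩
    have h3 := card_le_card h2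
    rw [card_disjSum, card_union_of_disjoint hdisj, card_product, card_univ, Fintype.card_fin] at h3
    have h4 := hC A Yᶜ
    have h5 : #{p : Fin n × Fin n | C p.1 p.2 ∧ p.1 ∈ A ∧ p.2 ∈ Yᶜ} = #D := by
      rw [← card_map (Function.Embedding.subtype _)]
      congr 1
      ext p
      simp [D, E]
      tauto
    rw [h5, card_compl, Fintype.card_fin] at h4
    have h6 : #Y ≤ n := by simpa using card_le_univ Y
    have h7 : r * (n - #Y) + #Y * r = r * n := by
      rw [mul_comm (#Y), ← mul_add, Nat.sub_add_cancel h6]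
    rw [← card_toLeft_add_card_toRight]
    omega
  obtain ⟨f, hf, hft⟩ := (all_card_le_biUnion_card_iff_exists_injective t).1 hall
  have hl : ∀ p : Fin n × Fin r, ∃ e : E, f (Sum.inl p) = Sum.inl e ∧ e.1.1 = p.1 := by
    intro p
    have := hft (Sum.inl p)
    simp only [t, mem_disjSum] at this
    rcases this with ⟨e, he, h⟩ | ⟨q, hq, h⟩
    · exact ⟨e, h.symm, (mem_filter.1 he).2⟩
    · simp at hq
  choose e he hex using hl
  have hr : ∀ p : Fin n × Fin r, ∃ i : Fin r, f (Sum.inr (e p)) = Sum.inr ((e p).1.2, i) := by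
    intro p
    have := hft (Sum.inr (e p))
    simp only [t, mem_disjSum] at this
    rcases this with ⟨e', he', h⟩ | ⟨q, hq, h⟩
    · rw [mem_singleton] at he'
      rw [he', ← he p] at h
      exact absurd (hf h) (by simp)
    · have := (mem_filter.1 hq).2
      exact ⟨q.2, by rw [← h, ← this]⟩
  choose i hi using hr
  have he_inj : Function.Injective e := fun p q h => by
    have : f (Sum.inl p) = f (Sum.inl q) := by rw [he, he, h]
    simpa using hf this
  refine ⟨fun x j => (e (x, j)).1.2, fun x j => ?_, fun x j j' h => ?_, fun y => ?_⟩
  · have := (e (x, j)).2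
    rwa [hex] at this
  · have : e (x, j) = e (x, j') := Subtype.ext (Prod.ext (by rw [hex, hex]) h)
    simpa using he_inj this
  · have := card_le_card_of_injOn (s := ({p : Fin n × Fin r | (e (p.1, p.2)).1.2 = y} : Finset _))
      (t := (univ : Finset (Fin r))) i (by simp) (by
        intro p hp q hq h
        simp only [coe_filter, mem_univ, true_and, Set.mem_ofPred_eq] at hp hq
        have h1 : f (Sum.inr (e p)) = f (Sum.inr (e q)) := by
          rw [hi, hi, h]
          congr 2
          exact hp.trans hq.symm
        exact he_inj (by simpa using hf h1))
    simpa using this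

open Finset in
/-- If the bipartite graph of allowed pairs has an `r`-regular spanning subgraph, then some
allowed perfect matching costs at most a `1/r` fraction of the total cost. -/
theorem exists_cheap_perm_of_selection {n r : ℕ} (hr : 0 < r) (C : Fin n → Fin n → Prop) [DecidableRel C]
    (g : Fin n → Fin r → Fin n) (hgC : ∀ x i, C x (g x i)) (hg : ∀ x, Function.Injective (g x))
    (hgy : ∀ y, #{p : Fin n × Fin r | g p.1 p.2 = y} ≤ r)
    (w : Fin n → Fin n → ℝ) (hw : ∀ x y, 0 ≤ w x y) :
    ∃ σ : Equiv.Perm (Fin n), (∀ x, C x (σ x)) ∧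
      (r : ℝ) * ∑ x, w x (σ x) ≤ ∑ x, ∑ y, w x y := by
  classical
  have hr' : (0 : ℝ) < r := by exact_mod_cast hr
  let N : Fin n → Fin n → ℕ := fun x y => #{i | g x i = y}
  have hN1 : ∀ x y, N x y ≤ 1 := fun x y => by
    rw [card_le_one]
    intro a ha b hb
    exact hg x ((mem_filter.1 ha).2.trans (mem_filter.1 hb).2.symm)
  have hrow : ∀ x, ∑ y, N x y = r := fun x => by
    have := card_eq_sum_card_fiberwise (f := g x) (s := univ) (t := univ) (by simp)
    simpa [N] using this.symm
  have hcol' : ∀ y, ∑ x, N x y = #{p : Fin n × Fin r | g p.1 p.2 = y} := fun y => by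
    rw [card_filter, Fintype.sum_prod_type]
    exact sum_congr rfl fun x _ => card_filter _ _
  -- Both totals are `n * r`, so the column bounds are all equalities.
  have hcol : ∀ y, ∑ x, N x y = r := by
    have h1 : ∑ y, ∑ x, N x y = ∑ _y : Fin n, r := by
      rw [sum_comm]
      exact sum_congr rfl fun x _ => hrow x
    have h2 := (sum_eq_sum_iff_of_le (fun y _ => (hcol' y).le.trans (hgy y))).1 h1
    exact fun y => h2 y (mem_univ y)
  let M : Matrix (Fin n) (Fin n) ℝ := fun x y => (N x y : ℝ) / r
  have hM : M ∈ doublyStochastic ℝ (Fin n) := by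
    rw [mem_doublyStochastic_iff_sum]
    refine ⟨fun i j => by positivity, fun x => ?_, fun y => ?_⟩
    · rw [← sum_div, ← Nat.cast_sum, hrow, div_self hr'.ne']
    · rw [← sum_div, ← Nat.cast_sum, hcol, div_self hr'.ne']
  obtain ⟨c, hc0, hc1, hcM⟩ := exists_eq_sum_perm_of_mem_doublyStochastic hM
  have hent : ∀ x y, M x y = ∑ σ : Equiv.Perm (Fin n), c σ * if σ x = y then 1 else 0 := by
    intro x y
    rw [← hcM, Matrix.sum_apply]
    simp [Equiv.Perm.permMatrix, PEquiv.toMatrix_apply, eq_comm]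
  have hsupp : ∀ σ, 0 < c σ → ∀ x, C x (σ x) := by
    intro σ hσ x
    have h1 : 0 < M x (σ x) := by
      rw [hent]
      refine sum_pos' (fun τ _ => mul_nonneg (hc0 τ) (by split_ifs <;> norm_num))
        ⟨σ, mem_univ _, by simpa using hσ⟩
    have h2 : 0 < N x (σ x) := by
      rcases Nat.eq_zero_or_pos (N x (σ x)) with h | h
      · simp [M, h] at h1
      · exact h
    obtain ⟨i, hi⟩ := card_pos.1 h2
    rw [← (mem_filter.1 hi).2]
    exact hgC x i
  have havg : ∑ σ, c σ * ∑ x, w x (σ x) = ∑ x, ∑ y, M x y * w x y := by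
    simp_rw [hent, mul_sum, sum_mul]
    rw [sum_comm]
    refine sum_congr rfl fun x _ => ?_
    rw [sum_comm]
    refine sum_congr rfl fun σ _ => ?_
    simp
  have hle : ∑ x, ∑ y, M x y * w x y ≤ (∑ x, ∑ y, w x y) / r := by
    rw [sum_div]
    refine sum_le_sum fun x _ => ?_
    rw [sum_div]
    refine sum_le_sum fun y _ => ?_
    have : (N x y : ℝ) ≤ 1 := by exact_mod_cast hN1 x y
    simp only [M]
    rw [div_mul_eq_mul_div]
    gcongr
    exact mul_le_of_le_one_left (hw x y) this
  by_contra! hcon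
  have hlt : ∑ σ, c σ * ((∑ x, ∑ y, w x y) / r) < ∑ σ, c σ * ∑ x, w x (σ x) := by
    refine sum_lt_sum (fun σ _ => ?_) ?_
    · rcases (hc0 σ).eq_or_lt with h | h
      · simp [← h]
      · have := hcon σ (hsupp σ h)
        refine mul_le_mul_of_nonneg_left ?_ h.le
        rw [div_le_iff₀ hr', mul_comm]
        exact this.le
    · obtain ⟨σ, -, hσ⟩ : ∃ σ ∈ (univ : Finset (Equiv.Perm (Fin n))), 0 < c σ := by
        by_contra! h
        have := sum_nonpos h
        linarith
      refine ⟨σ, mem_univ _, mul_lt_mul_of_pos_left ?_ hσ⟩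
      rw [div_lt_iff₀ hr', mul_comm]
      exact hcon σ (hsupp σ hσ)
  rw [← sum_mul, hc1, one_mul] at hlt
  linarith

open Finset in
/-- If the forbidden pairs have maximum degree at most `m`, at most `m * min |A| |B|` of them lie
between `A` and `B`. -/
theorem card_mul_card_le_card_allowed {n m : ℕ} (C : Fin n → Fin n → Prop) [DecidableRel C]
    (hrow : ∀ x, #{y | ¬ C x y} ≤ m) (hcol : ∀ y, #{x | ¬ C x y} ≤ m) (A B : Finset (Fin n)) :
    #A * #B ≤ #{p : Fin n × Fin n | C p.1 p.2 ∧ p.1 ∈ A ∧ p.2 ∈ B} + m * min #A #B := by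
  classical
  have h1 : #A * #B = #{p ∈ A ×ˢ B | C p.1 p.2} + #{p ∈ A ×ˢ B | ¬ C p.1 p.2} := by
    rw [card_filter_add_card_filter_not, card_product]
  have h2 : #{p ∈ A ×ˢ B | C p.1 p.2} =
      #{p : Fin n × Fin n | C p.1 p.2 ∧ p.1 ∈ A ∧ p.2 ∈ B} := by
    congr 1
    ext p
    simp
    tauto
  have h3 : #{p ∈ A ×ˢ B | ¬ C p.1 p.2} ≤ m * #A := by
    rw [card_filter, sum_product, mul_comm, ← smul_eq_mul]
    refine sum_le_card_nsmul _ _ _ fun x _ => ?_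
    rw [← card_filter]
    exact (card_le_card (filter_subset_filter _ (subset_univ _))).trans (hrow x)
  have h4 : #{p ∈ A ×ˢ B | ¬ C p.1 p.2} ≤ m * #B := by
    rw [card_filter, sum_product_right, mul_comm, ← smul_eq_mul]
    refine sum_le_card_nsmul _ _ _ fun y _ => ?_
    rw [← card_filter]
    exact (card_le_card (filter_subset_filter _ (subset_univ _))).trans (hcol y)
  have h5 := le_min h3 h4
  rw [Nat.mul_min_mul_left] at h5
  omega

open Finset in
/-- A cheap allowed perfect matching, when every vertex has at most `m` forbidden partners. -/
theorem exists_cheap_perm {n m r : ℕ} (hr : 0 < r) (C : Fin n → Fin n → Prop) [DecidableRel C]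
    (hrow : ∀ x, #{y | ¬ C x y} ≤ m) (hcol : ∀ y, #{x | ¬ C x y} ≤ m)
    (hab : ∀ a b : ℕ, a ≤ n → b ≤ n → r * a + r * b + m * min a b ≤ a * b + r * n)
    (w : Fin n → Fin n → ℝ) (hw : ∀ x y, 0 ≤ w x y) :
    ∃ σ : Equiv.Perm (Fin n), (∀ x, C x (σ x)) ∧
      (r : ℝ) * ∑ x, w x (σ x) ≤ ∑ x, ∑ y, w x y := by
  obtain ⟨g, h1, h2, h3⟩ := exists_regular_selection (r := r) C fun A B => by
    have h1 := card_mul_card_le_card_allowed C hrow hcol A B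
    have h2 := hab #A #B (by simpa using card_le_univ A) (by simpa using card_le_univ B)
    omega
  exact exists_cheap_perm_of_selection hr C g h1 h2 h3 w hw

open Finset in
/-- Hall's theorem when any two forbidden sets overlap little. -/
theorem exists_perm_of_inter_le {n m c : ℕ} (H : Fin n → Finset (Fin n)) (hm : m < n)
    (hrow : ∀ x, #(H x) ≤ m) (hcol : ∀ y, #{x | y ∈ H x} ≤ m)
    (hc : ∀ x x', x ≠ x' → #(H x ∩ H x') ≤ c) (hcm : c + m ≤ n) :
    ∃ σ : Equiv.Perm (Fin n), ∀ x, σ x ∉ H x := by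
  classical
  have hall : ∀ s : Finset (Fin n), #s ≤ #(s.biUnion fun x => (H x)ᶜ) := by
    intro s
    -- If no label is forbidden to all of `s`, the neighbourhood of `s` is everything. Otherwise `#s
    -- ≤ m`, and two members of `s` already see at least `n - c ≥ m` labels.
    by_cases hy : ∃ y, ∀ x ∈ s, y ∈ H x
    · obtain ⟨y, hy⟩ := hy
      have hs : #s ≤ m := (card_le_card fun x hx => by simpa using hy x hx).trans (hcol y)
      rcases s.eq_empty_or_nonempty with rfl | ⟨x, hx⟩
      · simp
      by_cases h1 : #s ≤ 1
      · have h2 : #(H x)ᶜ ≤ #(s.biUnion fun x => (H x)ᶜ) :=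
          card_le_card (subset_biUnion_of_mem (fun x => (H x)ᶜ) hx)
        rw [card_compl, Fintype.card_fin] at h2
        have := hrow x
        omega
      · obtain ⟨a, ha, b, hb, hab⟩ := one_lt_card.1 (not_le.1 h1)
        have h2 : #(H a ∩ H b)ᶜ ≤ #(s.biUnion fun x => (H x)ᶜ) := by
          refine card_le_card ?_
          rw [compl_inter]
          exact union_subset (subset_biUnion_of_mem (fun x => (H x)ᶜ) ha)
            (subset_biUnion_of_mem (fun x => (H x)ᶜ) hb)
        rw [card_compl, Fintype.card_fin] at h2
        have := hc a b hab
        omega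
    · push Not at hy
      have : s.biUnion (fun x => (H x)ᶜ) = univ := by
        ext y
        simpa using hy y
      rw [this]
      exact card_le_univ s
  obtain ⟨f, hf, hfH⟩ := (all_card_le_biUnion_card_iff_exists_injective _).1 hall
  exact ⟨Equiv.ofBijective f (Finite.injective_iff_bijective.1 hf), fun x => by
    simpa using hfH x⟩

/-! ### Partial labellings, forbidden labels and codegrees -/

/-- Between the vertices `u` of part `i` and `v` of part `l`, the relation `A i l` is a matching. -/
structure IsMatchingFamily {n : ℕ} (A : ℕ → ℕ → Fin n → Fin n → Prop) : Prop where
  left_unique : ∀ {i l u u' v}, A i l u v → A i l u' v → u = u'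
  right_unique : ∀ {i l u v v'}, A i l u v → A i l u v' → v = v'

open Finset Classical in
/-- The labels of those neighbours of the vertex `v` of part `l` that lie in the first `m` parts,
where `σ i u` is the label of the vertex `u` of part `i`. -/
noncomputable def hits {n : ℕ} (A : ℕ → ℕ → Fin n → Fin n → Prop) (σ : ℕ → Equiv.Perm (Fin n))
    (m l : ℕ) (v : Fin n) : Finset (Fin n) :=
  univ.filter fun T => ∃ i < m, ∃ u, A i l u v ∧ σ i u = T

/-- No vertex of the first `m` parts has a neighbour with the same label in an earlier part. -/
def ProperLabels {n : ℕ} (A : ℕ → ℕ → Fin n → Fin n → Prop) (σ : ℕ → Equiv.Perm (Fin n))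
    (m : ℕ) : Prop :=
  ∀ i < m, ∀ x, σ i x ∉ hits A σ i i x

/-- The number of labels hit both from `v` and from `v'`. -/
noncomputable def codeg {n : ℕ} (A : ℕ → ℕ → Fin n → Fin n → Prop) (σ : ℕ → Equiv.Perm (Fin n))
    (m l : ℕ) (v v' : Fin n) : ℕ :=
  (hits A σ m l v ∩ hits A σ m l v').card

open Classical in
/-- Indicator that giving label `T` to the vertex `u` of part `m` makes `T` a new label hit from
`v` that was already hit from `v'`. -/
noncomputable def gain {n : ℕ} (A : ℕ → ℕ → Fin n → Fin n → Prop) (σ : ℕ → Equiv.Perm (Fin n))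
    (m l : ℕ) (v v' u T : Fin n) : ℕ :=
  if A m l u v ∧ T ∈ hits A σ m l v' \ hits A σ m l v then 1 else 0

section Hits

open Finset

variable {n : ℕ} {A : ℕ → ℕ → Fin n → Fin n → Prop} {σ : ℕ → Equiv.Perm (Fin n)}

theorem mem_hits {m l : ℕ} {v T : Fin n} :
    T ∈ hits A σ m l v ↔ ∃ i < m, ∃ u, A i l u v ∧ σ i u = T := by
  simp [hits]

theorem hits_congr {σ' : ℕ → Equiv.Perm (Fin n)} {m : ℕ} (h : ∀ i < m, σ i = σ' i) (l : ℕ)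
    (v : Fin n) : hits A σ m l v = hits A σ' m l v := by
  ext T
  simp only [mem_hits]
  refine exists_congr fun i => and_congr_right fun hi => ?_
  rw [h i hi]

theorem mem_hits_succ {m l : ℕ} {v T : Fin n} :
    T ∈ hits A σ (m + 1) l v ↔ T ∈ hits A σ m l v ∨ ∃ u, A m l u v ∧ σ m u = T := by
  simp only [mem_hits, Nat.lt_succ_iff_lt_or_eq]
  constructor
  · rintro ⟨i, hi | rfl, h⟩
    · exact Or.inl ⟨i, hi, h⟩
    · exact Or.inr h
  · rintro (⟨i, hi, h⟩ | h)
    · exact ⟨i, Or.inl hi, h⟩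
    · exact ⟨m, Or.inr rfl, h⟩

theorem card_hits_le (hA : IsMatchingFamily A) (m l : ℕ) (v : Fin n) :
    #(hits A σ m l v) ≤ m := by
  classical
  have hsub : hits A σ m l v ⊆
      (range m).biUnion fun i => univ.filter fun T => ∃ u, A i l u v ∧ σ i u = T := by
    intro T hT
    obtain ⟨i, hi, h⟩ := mem_hits.1 hT
    exact mem_biUnion.2 ⟨i, mem_range.2 hi, by simpa using h⟩
  refine (card_le_card hsub).trans ((card_biUnion_le_card_mul _ _ 1 fun i _ => ?_).trans (by simp))
  rw [card_le_one]
  intro a ha b hb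
  obtain ⟨u, hu, rfl⟩ := (mem_filter.1 ha).2
  obtain ⟨u', hu', rfl⟩ := (mem_filter.1 hb).2
  rw [hA.left_unique hu hu']

theorem card_hit_from_le (hA : IsMatchingFamily A) (m l : ℕ) (T : Fin n) :
    #{v | T ∈ hits A σ m l v} ≤ m := by
  classical
  have hsub : ({v | T ∈ hits A σ m l v} : Finset (Fin n)) ⊆
      (range m).biUnion fun i => univ.filter fun v => A i l ((σ i).symm T) v := by
    intro v hv
    obtain ⟨i, hi, u, hu, rfl⟩ := mem_hits.1 (mem_filter.1 hv).2
    exact mem_biUnion.2 ⟨i, mem_range.2 hi, by simpa using hu⟩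
  refine (card_le_card hsub).trans ((card_biUnion_le_card_mul _ _ 1 fun i _ => ?_).trans (by simp))
  rw [card_le_one]
  intro a ha b hb
  exact hA.right_unique (mem_filter.1 ha).2 (mem_filter.1 hb).2

theorem codeg_comm (m l : ℕ) (v v' : Fin n) : codeg A σ m l v v' = codeg A σ m l v' v := by
  rw [codeg, codeg, inter_comm]

theorem sum_gain_le_one (hA : IsMatchingFamily A) (m l : ℕ) (v v' : Fin n)
    (τ : Fin n → Fin n) : ∑ u, gain A σ m l v v' u (τ u) ≤ 1 := by
  classical
  simp only [gain]
  rw [← card_filter, card_le_one]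
  intro a ha b hb
  exact hA.left_unique (mem_filter.1 ha).2.1 (mem_filter.1 hb).2.1

/-- Only the neighbour of `v` in part `m` can produce a gain, and only with one of the at most `m -
codeg` labels hit from `v'` but not from `v`. The term `- codeg` gives the drift its
self-correction. -/
theorem sum_sum_gain_add_codeg_le (hA : IsMatchingFamily A) (m l : ℕ) (v v' : Fin n) :
    ∑ u, ∑ T, gain A σ m l v v' u T + codeg A σ m l v v' ≤ m := by
  classical
  have h1 : ∑ u, ∑ T, gain A σ m l v v' u T ≤ #(hits A σ m l v' \ hits A σ m l v) := by
    rw [sum_comm, card_eq_sum_ones, ← sum_filter_add_sum_filter_not univ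
      (· ∈ hits A σ m l v' \ hits A σ m l v)]
    have h0 : ∑ T with T ∉ hits A σ m l v' \ hits A σ m l v, ∑ u, gain A σ m l v v' u T = 0 :=
      sum_eq_zero fun T hT => sum_eq_zero fun u _ =>
        if_neg fun h => (mem_filter.1 hT).2 h.2
    rw [h0, add_zero, filter_mem_eq_inter, univ_inter]
    exact sum_le_sum fun T _ => sum_gain_le_one hA m l v v' fun _ => T
  have h2 := card_sdiff_add_card_inter (hits A σ m l v') (hits A σ m l v)
  have h3 := card_hits_le (σ := σ) hA m l v'
  rw [codeg_comm]
  unfold codeg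
  omega

theorem codeg_succ_le (hA : IsMatchingFamily A) (m l : ℕ) {v v' : Fin n} (hv : v ≠ v') :
    codeg A σ (m + 1) l v v' ≤ codeg A σ m l v v' +
      ∑ u, (gain A σ m l v v' u (σ m u) + gain A σ m l v' v u (σ m u)) := by
  classical
  have key : ∀ v v' : Fin n, #(univ.filter fun T =>
      T ∈ hits A σ m l v' \ hits A σ m l v ∧ ∃ u, A m l u v ∧ σ m u = T) ≤
      ∑ u, gain A σ m l v v' u (σ m u) := by
    intro v v'
    simp only [gain]
    rw [← card_filter]
    refine (card_le_card ?_).trans (card_image_le (f := σ m))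
    intro T hT
    obtain ⟨h1, u, hu, rfl⟩ := (mem_filter.1 hT).2
    exact mem_image_of_mem _ (mem_filter.2 ⟨mem_univ _, hu, h1⟩)
  have hsub : hits A σ (m + 1) l v ∩ hits A σ (m + 1) l v' ⊆
      (hits A σ m l v ∩ hits A σ m l v') ∪
      ((univ.filter fun T => T ∈ hits A σ m l v' \ hits A σ m l v ∧ ∃ u, A m l u v ∧ σ m u = T) ∪
      (univ.filter fun T =>
        T ∈ hits A σ m l v \ hits A σ m l v' ∧ ∃ u, A m l u v' ∧ σ m u = T)) := by
    intro T hT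
    simp only [mem_inter, mem_hits_succ] at hT
    simp only [mem_union, mem_inter, mem_filter, mem_univ, true_and, mem_sdiff]
    -- Part `m` cannot hit one label from both vertices: a single vertex of it carries that label,
    -- and it has at most one neighbour in part `l`.
    have hne : ¬ ((∃ u, A m l u v ∧ σ m u = T) ∧ ∃ u, A m l u v' ∧ σ m u = T) := by
      rintro ⟨⟨u, hu, h⟩, u', hu', h'⟩
      obtain rfl := (σ m).injective (h.trans h'.symm)
      exact hv (hA.right_unique hu hu')
    by_cases h1 : T ∈ hits A σ m l v <;> by_cases h2 : T ∈ hits A σ m l v' <;> simp_all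
  have h1 := card_le_card hsub
  have h2 := card_union_le (hits A σ m l v ∩ hits A σ m l v')
    ((univ.filter fun T => T ∈ hits A σ m l v' \ hits A σ m l v ∧ ∃ u, A m l u v ∧ σ m u = T) ∪
      (univ.filter fun T =>
        T ∈ hits A σ m l v \ hits A σ m l v' ∧ ∃ u, A m l u v' ∧ σ m u = T))
  have h3 := card_union_le
    (univ.filter fun T => T ∈ hits A σ m l v' \ hits A σ m l v ∧ ∃ u, A m l u v ∧ σ m u = T)
    (univ.filter fun T => T ∈ hits A σ m l v \ hits A σ m l v' ∧ ∃ u, A m l u v' ∧ σ m u = T)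
  have h4 := key v v'
  have h5 := key v' v
  rw [sum_add_distrib]
  unfold codeg
  omega

theorem codeg_succ_le_add_two (hA : IsMatchingFamily A) (m l : ℕ) {v v' : Fin n} (hv : v ≠ v') :
    codeg A σ (m + 1) l v v' ≤ codeg A σ m l v v' + 2 := by
  have h1 := codeg_succ_le (σ := σ) hA m l hv
  rw [sum_add_distrib] at h1
  have h2 := sum_gain_le_one (σ := σ) hA m l v v' (σ m)
  have h3 := sum_gain_le_one (σ := σ) hA m l v' v (σ m)
  omega

theorem hits_update (m : ℕ) (τ : Equiv.Perm (Fin n)) {j : ℕ} (hj : j ≤ m) (l : ℕ) (v : Fin n) :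
    hits A (Function.update σ m τ) j l v = hits A σ j l v :=
  hits_congr (fun _ hi => Function.update_of_ne (hi.trans_le hj).ne _ _) l v

theorem ProperLabels.update {m : ℕ} (h : ProperLabels A σ m) {τ : Equiv.Perm (Fin n)}
    (hτ : ∀ x, τ x ∉ hits A σ m m x) : ProperLabels A (Function.update σ m τ) (m + 1) := by
  intro i hi x
  rw [hits_update m τ (by omega)]
  rcases Nat.lt_succ_iff_lt_or_eq.1 hi with hi | rfl
  · rw [Function.update_of_ne hi.ne]
    exact h i hi x
  · rw [Function.update_self]
    exact hτ x

theorem codeg_update (m : ℕ) (τ : Equiv.Perm (Fin n)) (l : ℕ) (v v' : Fin n) :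
    codeg A (Function.update σ m τ) m l v v' = codeg A σ m l v v' := by
  rw [codeg, codeg, hits_update m τ le_rfl, hits_update m τ le_rfl]

theorem gain_update (m : ℕ) (τ : Equiv.Perm (Fin n)) (l : ℕ) (v v' u T : Fin n) :
    gain A (Function.update σ m τ) m l v v' u T = gain A σ m l v v' u T := by
  rw [gain, gain, hits_update m τ le_rfl, hits_update m τ le_rfl]

/-! ### The exponential potential and the two labelling phases -/

/-- By convexity the chord over `[0, 2]` lies above the exponential. Linearity in `z` lets a bound
on total cost control the potential. -/
theorem exp_mul_le_of_le_two (z : ℕ) (hz : z ≤ 2) (a : ℝ) :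
    Real.exp (a * z) ≤ 1 + (Real.exp (2 * a) - 1) / 2 * z := by
  have h2 : Real.exp (2 * a) = Real.exp a ^ 2 := by rw [← Real.exp_nat_mul]; norm_num
  interval_cases z
  · simp
  · rw [h2]
    push_cast
    rw [mul_one]
    nlinarith [sq_nonneg (Real.exp a - 1)]
  · push_cast
    rw [mul_comm a]
    linarith

/-- One step of the derandomized process: the next part can be labelled so that the exponential
potential of the codegrees barely grows. -/
theorem exists_potential_step (hA : IsMatchingFamily A) {m r : ℕ} (hr : 0 < r)
    (hab : ∀ a b : ℕ, a ≤ n → b ≤ n → r * a + r * b + m * min a b ≤ a * b + r * n)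
    (P : Finset (ℕ × Fin n × Fin n)) (hP : ∀ p ∈ P, p.2.1 ≠ p.2.2) {a F F' : ℝ} (ha : 0 ≤ a)
    (hF : F ≤ F') (hstep : (Real.exp (2 * a) - 1) * (m - F) ≤ a * (F' - F) * r) :
    ∃ τ : Equiv.Perm (Fin n), (∀ x, τ x ∉ hits A σ m m x) ∧
      ∑ p ∈ P, Real.exp (a * (codeg A (Function.update σ m τ) (m + 1) p.1 p.2.1 p.2.2 - F')) ≤
        ∑ p ∈ P, Real.exp (a * (codeg A σ m p.1 p.2.1 p.2.2 - F)) + #P * Real.exp (2 * a) := by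
  classical
  let c : ℕ × Fin n × Fin n → ℝ := fun p => codeg A σ m p.1 p.2.1 p.2.2
  let E : ℕ × Fin n × Fin n → ℝ := fun p => Real.exp (a * (c p - F))
  -- Only pairs on or above the trajectory are weighted, so `m - c ≤ m - F` for them. The others end
  -- below `F' + 2` and contribute at most `exp (2 * a)` each.
  let G := P.filter fun p => F ≤ c p
  let d : ℕ × Fin n × Fin n → Fin n → Fin n → ℕ := fun p u T =>
    gain A σ m p.1 p.2.1 p.2.2 u T + gain A σ m p.1 p.2.2 p.2.1 u T
  obtain ⟨τ, hτ, hcost⟩ := exists_cheap_perm hr (fun x T => T ∉ hits A σ m m x)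
    (fun x => by simpa [filter_mem_eq_inter] using card_hits_le (σ := σ) hA m m x)
    (fun T => by simpa using card_hit_from_le (σ := σ) hA m m T) hab
    (fun u T => ∑ p ∈ G, E p * d p u T)
    (fun u T => sum_nonneg fun p _ => by positivity)
  refine ⟨τ, hτ, ?_⟩
  set S := ∑ p ∈ G, E p with hS
  let z : ℕ × Fin n × Fin n → ℕ := fun p => ∑ u, d p u (τ u)
  have hz2 : ∀ p, z p ≤ 2 := fun p => by
    have h2 := sum_gain_le_one (σ := σ) hA m p.1 p.2.1 p.2.2 τ
    have h3 := sum_gain_le_one (σ := σ) hA m p.1 p.2.2 p.2.1 τ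
    simp only [z, d, sum_add_distrib]
    omega
  have hc' : ∀ p ∈ P,
      (codeg A (Function.update σ m τ) (m + 1) p.1 p.2.1 p.2.2 : ℝ) ≤ c p + z p := by
    intro p hp
    have h := codeg_succ_le (σ := Function.update σ m τ) hA m p.1 (hP p hp)
    simp only [codeg_update, gain_update, Function.update_self] at h
    simp only [c, z, d]
    exact_mod_cast h
  have hcost' : (r : ℝ) * ∑ p ∈ G, E p * z p ≤ 2 * (m - F) * S := by
    have h1 : ∑ u, ∑ p ∈ G, E p * (d p u (τ u) : ℝ) = ∑ p ∈ G, E p * z p := by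
      rw [sum_comm]
      refine sum_congr rfl fun p _ => ?_
      simp only [z]
      rw [← mul_sum, Nat.cast_sum]
    have h2 : ∑ u, ∑ T, ∑ p ∈ G, E p * (d p u T : ℝ) ≤ 2 * (m - F) * S := by
      have h3 : ∑ u, ∑ T, ∑ p ∈ G, E p * (d p u T : ℝ) =
          ∑ p ∈ G, E p * ((∑ u, ∑ T, d p u T : ℕ) : ℝ) := by
        simp_rw [Nat.cast_sum, mul_sum]
        refine (sum_congr rfl fun u _ => sum_comm).trans sum_comm
      rw [h3, hS, mul_sum]
      refine sum_le_sum fun p hp => ?_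
      rw [mul_comm]
      refine mul_le_mul_of_nonneg_right ?_ (Real.exp_nonneg _)
      have h4 := sum_sum_gain_add_codeg_le (σ := σ) hA m p.1 p.2.1 p.2.2
      have h5 := sum_sum_gain_add_codeg_le (σ := σ) hA m p.1 p.2.2 p.2.1
      rw [codeg_comm] at h5
      have h6 : ∑ u, ∑ T, d p u T + 2 * codeg A σ m p.1 p.2.1 p.2.2 ≤ 2 * m := by
        simp only [d, sum_add_distrib]
        omega
      have h7 : ((∑ u, ∑ T, d p u T : ℕ) : ℝ) + 2 * c p ≤ 2 * m := by
        simp only [c]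
        exact_mod_cast h6
      have h8 : F ≤ c p := (mem_filter.1 hp).2
      linarith
    rw [h1] at hcost
    exact hcost.trans h2
  have hgood : ∑ p ∈ G,
      Real.exp (a * (codeg A (Function.update σ m τ) (m + 1) p.1 p.2.1 p.2.2 - F')) ≤ S := by
    have hr' : (0 : ℝ) < r := by exact_mod_cast hr
    have hκ : 0 ≤ Real.exp (2 * a) - 1 := by
      have := Real.add_one_le_exp (2 * a)
      linarith
    have hS0 : 0 ≤ S := sum_nonneg fun p _ => Real.exp_nonneg _
    have h1 : ∀ p ∈ G,
        Real.exp (a * (codeg A (Function.update σ m τ) (m + 1) p.1 p.2.1 p.2.2 - F')) ≤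
        Real.exp (-(a * (F' - F))) * (E p + (Real.exp (2 * a) - 1) / 2 * (E p * z p)) := by
      intro p hp
      have h2 := hc' p (mem_filter.1 hp).1
      calc _ ≤ Real.exp (-(a * (F' - F)) + (a * (c p - F) + a * z p)) := by
            rw [Real.exp_le_exp]
            nlinarith
        _ = Real.exp (-(a * (F' - F))) * (E p * Real.exp (a * z p)) := by
            rw [Real.exp_add, Real.exp_add]
        _ ≤ Real.exp (-(a * (F' - F))) * (E p * (1 + (Real.exp (2 * a) - 1) / 2 * z p)) := by
            gcongr
            exact exp_mul_le_of_le_two _ (hz2 p) a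
        _ = _ := by ring
    refine (sum_le_sum h1).trans ?_
    rw [← mul_sum, sum_add_distrib, ← mul_sum]
    have h2 : (Real.exp (2 * a) - 1) / 2 * ∑ p ∈ G, E p * z p ≤ a * (F' - F) * S := by
      refine le_of_mul_le_mul_right ?_ hr'
      calc _ = (Real.exp (2 * a) - 1) / 2 * ((r : ℝ) * ∑ p ∈ G, E p * z p) := by ring
        _ ≤ (Real.exp (2 * a) - 1) / 2 * (2 * (m - F) * S) := by gcongr
        _ = (Real.exp (2 * a) - 1) * (m - F) * S := by ring
        _ ≤ a * (F' - F) * r * S := by gcongr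
        _ = _ := by ring
    have h3 : Real.exp (-(a * (F' - F))) * (1 + a * (F' - F)) ≤ 1 := by
      rw [Real.exp_neg, inv_mul_le_iff₀ (Real.exp_pos _), mul_one]
      linarith [Real.add_one_le_exp (a * (F' - F))]
    calc _ ≤ Real.exp (-(a * (F' - F))) * (S + a * (F' - F) * S) := by gcongr
      _ = Real.exp (-(a * (F' - F))) * (1 + a * (F' - F)) * S := by ring
      _ ≤ S := mul_le_of_le_one_left hS0 h3
  have hbad : ∑ p ∈ P with ¬ F ≤ c p,
      Real.exp (a * (codeg A (Function.update σ m τ) (m + 1) p.1 p.2.1 p.2.2 - F')) ≤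
      #P * Real.exp (2 * a) := by
    refine (sum_le_card_nsmul _ _ (Real.exp (2 * a)) fun p hp => ?_).trans ?_
    · obtain ⟨hp, hpF⟩ := mem_filter.1 hp
      have h1 := hc' p hp
      have h2 : (z p : ℝ) ≤ 2 := by exact_mod_cast hz2 p
      rw [Real.exp_le_exp, mul_comm 2]
      exact mul_le_mul_of_nonneg_left (by linarith) ha
    · rw [nsmul_eq_mul]
      gcongr
      exact filter_subset _ _
  have hsplit := sum_filter_add_sum_filter_not P (fun p => F ≤ c p) fun p =>
    Real.exp (a * (codeg A (Function.update σ m τ) (m + 1) p.1 p.2.1 p.2.2 - F'))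
  have hSP : S ≤ ∑ p ∈ P, E p :=
    sum_le_sum_of_subset_of_nonneg (filter_subset _ _) fun p _ _ => Real.exp_nonneg _
  rw [← hsplit]
  exact add_le_add (hgood.trans hSP) hbad

/-- The derandomized process, run for `M` steps. -/
theorem exists_properLabels_potential (hA : IsMatchingFamily A) {M : ℕ} (r : ℕ → ℕ) (F : ℕ → ℝ)
    (hr : ∀ m < M, 0 < r m)
    (hab : ∀ m < M, ∀ a b : ℕ, a ≤ n → b ≤ n →
      r m * a + r m * b + m * min a b ≤ a * b + r m * n)
    (P : Finset (ℕ × Fin n × Fin n)) (hP : ∀ p ∈ P, p.2.1 ≠ p.2.2) {a : ℝ} (ha : 0 ≤ a)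
    (hF0 : F 0 = 0) (hF : ∀ m < M, F m ≤ F (m + 1))
    (hstep : ∀ m < M, (Real.exp (2 * a) - 1) * (m - F m) ≤ a * (F (m + 1) - F m) * r m) :
    ∃ σ : ℕ → Equiv.Perm (Fin n), ProperLabels A σ M ∧
      ∑ p ∈ P, Real.exp (a * (codeg A σ M p.1 p.2.1 p.2.2 - F M)) ≤
        #P * (1 + M * Real.exp (2 * a)) := by
  suffices ∀ m ≤ M, ∃ σ : ℕ → Equiv.Perm (Fin n), ProperLabels A σ m ∧
      ∑ p ∈ P, Real.exp (a * (codeg A σ m p.1 p.2.1 p.2.2 - F m)) ≤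
        #P * (1 + m * Real.exp (2 * a)) from this M le_rfl
  intro m
  induction m with
  | zero =>
    intro _
    refine ⟨fun _ => 1, fun i hi => absurd hi (Nat.not_lt_zero i), ?_⟩
    have : ∀ l v v', codeg A (fun _ => (1 : Equiv.Perm (Fin n))) 0 l v v' = 0 := fun l v v' => by
      simp [codeg, hits]
    simp [this, hF0]
  | succ m ih =>
    intro hm
    obtain ⟨σ, hσ, hpot⟩ := ih (by omega)
    obtain ⟨τ, hτ, h⟩ := exists_potential_step (σ := σ) hA (hr m hm) (hab m hm) P hP ha (hF m hm)
      (hstep m hm)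
    refine ⟨_, hσ.update hτ, h.trans ?_⟩
    push_cast
    linarith

/-- Once the codegrees are small, the labelling can be continued greedily. -/
theorem exists_properLabels_of_codeg_le (hA : IsMatchingFamily A) {M c k : ℕ} (hM : M ≤ k)
    (hσ : ProperLabels A σ M) (hkn : k ≤ n)
    (hc : ∀ l < k, ∀ v v', v ≠ v' → codeg A σ M l v v' ≤ c)
    (hcn : ∀ m, M ≤ m → m < k → c + 2 * (m - M) + m ≤ n) :
    ∃ σ' : ℕ → Equiv.Perm (Fin n), ProperLabels A σ' k := by
  suffices ∀ m, M ≤ m → m ≤ k → ∃ σ' : ℕ → Equiv.Perm (Fin n), ProperLabels A σ' m ∧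
      ∀ l < k, ∀ v v', v ≠ v' → codeg A σ' m l v v' ≤ c + 2 * (m - M) from
    (this k hM le_rfl).imp fun _ h => h.1
  intro m hm
  induction m, hm using Nat.le_induction with
  | base => exact fun _ => ⟨σ, hσ, by simpa using hc⟩
  | succ m hm ih =>
    intro hmk
    obtain ⟨σ', hσ', hc'⟩ := ih (by omega)
    obtain ⟨τ, hτ⟩ := exists_perm_of_inter_le (m := m) (fun x => hits A σ' m m x) (by omega)
      (card_hits_le hA m m) (card_hit_from_le hA m m) (hc' m hmk) (hcn m hm hmk)
    refine ⟨_, hσ'.update hτ, fun l hl v v' hv => ?_⟩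
    have h1 := codeg_succ_le_add_two (σ := Function.update σ' m τ) hA m l hv
    rw [codeg_update] at h1
    have h2 := hc' l hl v v' hv
    omega

end Hits

/-! ### Numerical parameters -/

section Parameters

/-- The difference of the two sides is affine in `a`, so it suffices to look at `a = b` and `a = n`.
The former is a quadratic in `b` whose discriminant is nonpositive exactly by `hdisc`; the latter is
`b * (n - R)`. -/
theorem regularity_condition_aux {n R m a b : ℝ} (hR : R ≤ n)
    (hdisc : (2 * R - n - m) ^ 2 ≤ n ^ 2 - 2 * m * n) (hb : 0 ≤ b) (hba : b ≤ a) (han : a ≤ n) :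
    (R - m) * a + (R - m) * b + m * b ≤ a * b + (R - m) * n := by
  have h1 : 0 ≤ b ^ 2 - (2 * R - m) * b + (R - m) * n := by
    nlinarith [sq_nonneg (2 * b - (2 * R - m))]
  have h2 : 0 ≤ b * (n - R) := mul_nonneg hb (by linarith)
  have h3 : (n - b) * (a * b + (R - m) * n - ((R - m) * a + (R - m) * b + m * b)) =
      (n - a) * (b ^ 2 - (2 * R - m) * b + (R - m) * n) + (a - b) * (b * (n - R)) := by ring
  have h4 : 0 ≤ (n - b) * (a * b + (R - m) * n - ((R - m) * a + (R - m) * b + m * b)) := by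
    rw [h3]
    exact add_nonneg (mul_nonneg (by linarith) h1) (mul_nonneg (by linarith) h2)
  rcases (hba.trans han).eq_or_lt with h | h
  · obtain rfl : a = n := le_antisymm han (h ▸ hba)
    subst h
    nlinarith
  · linarith [nonneg_of_mul_nonneg_right h4 (by linarith : 0 < n - b)]

/-- The constants nearly exhaust the discriminant condition at `m = 0.485 n`: `0.173² < 1 - 0.97`.
-/
theorem regularity_condition {n R m : ℕ} (hR : (R : ℝ) ≤ 0.829 * n) (hR' : 0.82 * (n : ℝ) ≤ R)
    (hm : (m : ℝ) ≤ 0.485 * n) (a b : ℕ) (ha : a ≤ n) (hb : b ≤ n) :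
    (R - m) * a + (R - m) * b + m * min a b ≤ a * b + (R - m) * n := by
  have hn : (0 : ℝ) ≤ n := n.cast_nonneg
  have hm0 : (0 : ℝ) ≤ m := m.cast_nonneg
  have hmR : m ≤ R := by
    have : (m : ℝ) ≤ R := by linarith
    exact_mod_cast this
  have hdisc : (2 * (R : ℝ) - n - m) ^ 2 ≤ (n : ℝ) ^ 2 - 2 * m * n := by
    have h1 : (2 * (R : ℝ) - n - m) ^ 2 ≤ (0.658 * n - m) ^ 2 :=
      pow_le_pow_left₀ (by linarith) (by linarith) 2
    have h2 : (m : ℝ) * m ≤ m * (0.485 * n) := mul_le_mul_of_nonneg_left hm hm0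
    have h3 : (m : ℝ) * n ≤ 0.485 * n * n := mul_le_mul_of_nonneg_right hm hn
    nlinarith
  rcases le_total b a with h | h
  · rw [min_eq_right h]
    have := regularity_condition_aux (a := a) (b := b) (m := m) (R := R) (n := n) (by linarith)
      hdisc b.cast_nonneg (by exact_mod_cast h) (by exact_mod_cast ha)
    rw [← Nat.cast_sub hmR] at this
    exact_mod_cast this
  · rw [min_eq_left h]
    have := regularity_condition_aux (a := b) (b := a) (m := m) (R := R) (n := n) (by linarith)
      hdisc a.cast_nonneg (by exact_mod_cast h) (by exact_mod_cast hb)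
    rw [← Nat.cast_sub hmR] at this
    have h' : (R - m) * b + (R - m) * a + m * a ≤ b * a + (R - m) * n := by exact_mod_cast this
    linarith

/-- The function `m² / R` solves `F' = 2 (m - F) / (R - m)`. As `1.2065` slightly exceeds `1 /
0.829`, the slack absorbs the rounding of `R` and the second-order term of the exponential. -/
theorem potential_drift {n R m : ℕ} (hn : 20000 ≤ n) (hR : 0.829 * (n : ℝ) - 1 ≤ R)
    (hm : (m : ℝ) ≤ 0.485 * n) :
    (Real.exp (2 * 0.00005) - 1) * ((m : ℝ) - 1.2065 * (m : ℝ) ^ 2 / n) ≤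
      0.00005 * (1.2065 * ((m + 1 : ℕ) : ℝ) ^ 2 / n - 1.2065 * (m : ℝ) ^ 2 / n) *
        ((R - m : ℕ) : ℝ) := by
  have hn' : (20000 : ℝ) ≤ n := by exact_mod_cast hn
  have hn0 : (0 : ℝ) < n := by linarith
  have hm0 : (0 : ℝ) ≤ m := m.cast_nonneg
  have hmR : m ≤ R := by
    have : (m : ℝ) ≤ R := by linarith
    exact_mod_cast this
  have hexp : Real.exp (2 * 0.00005) - 1 ≤ 0.0001 * (1 + 0.0001) := by
    have := Real.abs_exp_sub_one_sub_id_le (x := 2 * 0.00005) (by norm_num [abs_le])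
    have := (abs_le.1 this).2
    norm_num at this ⊢
    linarith
  have h1 : (m : ℝ) - 1.2065 * (m : ℝ) ^ 2 / n = m * (n - 1.2065 * m) / n := by
    field_simp
  have h2 : 0 ≤ (m : ℝ) * (n - 1.2065 * m) / n :=
    div_nonneg (mul_nonneg hm0 (by linarith)) hn0.le
  have hRm : (0 : ℝ) ≤ R - m := by linarith
  rw [h1, Nat.cast_sub hmR]
  refine (mul_le_mul_of_nonneg_right hexp h2).trans ?_
  have h3 : 1.2065 * ((m + 1 : ℕ) : ℝ) ^ 2 / n - 1.2065 * (m : ℝ) ^ 2 / n =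
      (1.2065 * (2 * m + 1)) / n := by
    push_cast
    ring
  rw [h3, mul_div_assoc', mul_div_assoc', div_mul_eq_mul_div]
  refine div_le_div_of_nonneg_right ?_ hn0.le
  have h4 : (1 + 0.0001) * (n - 1.2065 * m) ≤ 1.2065 * ((R : ℝ) - m) := by linarith
  have h5 := mul_le_mul_of_nonneg_left h4 hm0
  nlinarith

theorem eventually_pow_le_exp : ∃ N : ℕ, ∀ n : ℕ, N ≤ n →
    (n : ℝ) ^ 5 ≤ Real.exp (0.00005 * (0.0001 * n)) := by
  have h := (isLittleO_pow_exp_pos_mul_atTop 5 (b := 0.00005 * 0.0001) (by norm_num)).bound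
    (c := 1) one_pos
  have h' := tendsto_natCast_atTop_atTop (R := ℝ) |>.eventually h
  obtain ⟨N, hN⟩ := Filter.eventually_atTop.1 h'
  refine ⟨N, fun n hn => ?_⟩
  have := hN n hn
  rw [one_mul, Real.norm_of_nonneg (by positivity), Real.norm_of_nonneg (Real.exp_nonneg _),
    mul_assoc] at this
  exact this

open Finset in
/-- For large `n`, a family of `⌈0.562 n⌉` parts of size `n` with matchings between them has a
proper labelling. -/
theorem exists_properLabels : ∃ N : ℕ, ∀ n : ℕ, N ≤ n →
    ∀ A : ℕ → ℕ → Fin n → Fin n → Prop, IsMatchingFamily A →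
      ∃ σ : ℕ → Equiv.Perm (Fin n), ProperLabels A σ ⌈(0.562 : ℝ) * n⌉₊ := by
  obtain ⟨N, hN⟩ := eventually_pow_le_exp
  refine ⟨max N 20000, fun n hn A hA => ?_⟩
  have hexp := hN n ((le_max_left _ _).trans hn)
  have hn' : 20000 ≤ n := (le_max_right _ _).trans hn
  have hnR : (20000 : ℝ) ≤ n := by exact_mod_cast hn'
  set k := ⌈(0.562 : ℝ) * n⌉₊ with hk
  set M := ⌊(0.485 : ℝ) * n⌋₊ with hM
  set R := ⌊(0.829 : ℝ) * n⌋₊ with hR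
  have hM1 : (M : ℝ) ≤ 0.485 * n := Nat.floor_le (by positivity)
  have hM2 : 0.485 * (n : ℝ) < M + 1 := Nat.lt_floor_add_one _
  have hR1 : (R : ℝ) ≤ 0.829 * n := Nat.floor_le (by positivity)
  have hR2 : 0.829 * (n : ℝ) < R + 1 := Nat.lt_floor_add_one _
  have hk1 : (k : ℝ) < 0.562 * n + 1 := Nat.ceil_lt_add_one (by positivity)
  have hk2 : 0.562 * (n : ℝ) ≤ k := Nat.le_ceil _
  have hkn : k ≤ n := by
    have : (k : ℝ) ≤ n := by linarith
    exact_mod_cast this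
  have hMk : M ≤ k := by
    have : (M : ℝ) ≤ k := by linarith
    exact_mod_cast this
  have hmM : ∀ m < M, (m : ℝ) ≤ 0.485 * n := fun m hm =>
    le_trans (by exact_mod_cast hm.le) hM1
  let P : Finset (ℕ × Fin n × Fin n) := (range k ×ˢ univ).filter fun p => p.2.1 ≠ p.2.2
  have hPcard : (#P : ℝ) ≤ (n : ℝ) ^ 3 := by
    have h1 : #P ≤ k * (n * n) := (card_filter_le _ _).trans (by simp [card_product])
    have h2 : k * (n * n) ≤ n ^ 3 := by
      calc k * (n * n) ≤ n * (n * n) := Nat.mul_le_mul_right _ hkn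
        _ = n ^ 3 := by ring
    exact_mod_cast h1.trans h2
  obtain ⟨σ, hσ, hpot⟩ := exists_properLabels_potential hA (M := M) (fun m => R - m)
    (fun m => 1.2065 * (m : ℝ) ^ 2 / n)
    (fun m hm => by
      have : (m : ℝ) < R := by linarith [hmM m hm]
      exact Nat.sub_pos_of_lt (by exact_mod_cast this))
    (fun m hm => regularity_condition hR1 (by linarith) (hmM m hm))
    P (fun p hp => (mem_filter.1 hp).2) (a := 0.00005) (by norm_num) (by simp)
    (fun m hm => by
      have : (m : ℝ) ≤ ((m + 1 : ℕ) : ℝ) := by push_cast; linarith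
      gcongr)
    (fun m hm => potential_drift hn' (by linarith) (hmM m hm))
  have htotal : (#P : ℝ) * (1 + M * Real.exp (2 * 0.00005)) ≤ (n : ℝ) ^ 5 := by
    have h1 : Real.exp (2 * 0.00005) ≤ 3 :=
      (Real.exp_le_exp.2 (by norm_num)).trans Real.exp_one_lt_three.le
    have h2 : (M : ℝ) * Real.exp (2 * 0.00005) ≤ M * 3 :=
      mul_le_mul_of_nonneg_left h1 M.cast_nonneg
    calc (#P : ℝ) * (1 + M * Real.exp (2 * 0.00005)) ≤ (n : ℝ) ^ 3 * (n : ℝ) ^ 2 := by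
          refine mul_le_mul hPcard ?_ (by positivity) (by positivity)
          nlinarith
      _ = (n : ℝ) ^ 5 := by ring
  have hcod : ∀ l < k, ∀ v v', v ≠ v' →
      codeg A σ M l v v' ≤ ⌊1.2065 * (M : ℝ) ^ 2 / n + 0.0001 * n⌋₊ := by
    intro l hl v v' hv
    have hp : (l, v, v') ∈ P := by simp [P, hl, hv]
    have h1 := single_le_sum (f := fun p : ℕ × Fin n × Fin n =>
      Real.exp (0.00005 * (codeg A σ M p.1 p.2.1 p.2.2 - 1.2065 * (M : ℝ) ^ 2 / n)))
      (fun p _ => Real.exp_nonneg _) hp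
    have h2 := Real.exp_le_exp.1 (h1.trans (hpot.trans (htotal.trans hexp)))
    refine Nat.le_floor ?_
    simp only at h2
    linarith
  refine exists_properLabels_of_codeg_le hA hMk hσ hkn hcod fun m hMm hmk => ?_
  have hF : 1.2065 * (M : ℝ) ^ 2 / n ≤ 1.2065 * 0.485 ^ 2 * n := by
    rw [div_le_iff₀ (by linarith)]
    nlinarith [pow_le_pow_left₀ M.cast_nonneg hM1 2]
  have hfl : (⌊1.2065 * (M : ℝ) ^ 2 / n + 0.0001 * n⌋₊ : ℝ) ≤
      1.2065 * (M : ℝ) ^ 2 / n + 0.0001 * n := Nat.floor_le (by positivity)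
  have hmk' : (m : ℝ) < 0.562 * n := Nat.lt_ceil.1 hmk
  -- The coefficients `1.2065 * 0.485² + 0.0001 + 2 * 0.077 + 0.562` sum to just under `0.9999`. The
  -- remaining slack covers the rounding error 2 from `M` once `n ≥ 20000`.
  have : ((⌊1.2065 * (M : ℝ) ^ 2 / n + 0.0001 * n⌋₊ + 2 * (m - M) + m : ℕ) : ℝ) ≤ n := by
    push_cast [Nat.cast_sub hMm]
    linarith
  exact_mod_cast this

end Parameters

/-! ### From labellings to graphs, and the upper bound -/

section Graphs

theorem everyKN1GraphHasFactor_of_properLabels {k n : ℕ}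
    (h : ∀ A : ℕ → ℕ → Fin n → Fin n → Prop, IsMatchingFamily A →
      ∃ σ : ℕ → Equiv.Perm (Fin n), ProperLabels A σ k) : EveryKN1GraphHasFactor k n := by
  intro V G P hG
  have he : ∀ i : Fin k, Nonempty (Fin n ≃ P.colorClass i) := fun i => by
    have h1 := hG.encard_part i
    have hfin : (P.colorClass i).Finite := Set.finite_of_encard_eq_coe h1
    have : Finite (P.colorClass i) := hfin
    refine ⟨(Finite.equivFinOfCardEq ?_).symm⟩
    rw [Nat.card_coe_set_eq, Set.ncard_def, h1, ENat.toNat_natCast]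
  let e : ∀ i : Fin k, Fin n ≃ P.colorClass i := fun i => (he i).some
  have hcol : ∀ (i : Fin k) (u : Fin n), P (e i u) = i := fun i u => (e i u).2
  have hne : ∀ {i j : Fin k} {u v : Fin n}, G.Adj (e i u) (e j v) → i ≠ j := by
    intro i j u v hadj hij
    exact P.valid hadj (by rw [hcol, hcol, hij])
  obtain ⟨σ, hσ⟩ := h
    (fun i l u v => ∃ (hi : i < k) (hl : l < k), G.Adj (e ⟨i, hi⟩ u) (e ⟨l, hl⟩ v))
    { left_unique := by
        rintro i l u u' v ⟨hi, hl, h1⟩ ⟨_, _, h2⟩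
        have := hG.matching _ _ (hne h1.symm) _ (e ⟨l, hl⟩ v).2 _ (e ⟨i, hi⟩ u).2 _
          (e ⟨i, hi⟩ u').2 h1.symm h2.symm
        exact (e ⟨i, hi⟩).injective (Subtype.ext this)
      right_unique := by
        rintro i l u v v' ⟨hi, hl, h1⟩ ⟨_, _, h2⟩
        have := hG.matching _ _ (hne h1) _ (e ⟨i, hi⟩ u).2 _ (e ⟨l, hl⟩ v).2 _
          (e ⟨l, hl⟩ v').2 h1 h2
        exact (e ⟨l, hl⟩).injective (Subtype.ext this) }
  have hind : ∀ {i j : Fin k} (T : Fin n), i < j →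
      ¬ G.Adj (e i ((σ i).symm T)) (e j ((σ j).symm T)) := by
    intro i j T hij hadj
    refine hσ j j.2 ((σ j).symm T) (mem_hits.2 ⟨i, hij, (σ i).symm T, ⟨i.2, j.2, hadj⟩, ?_⟩)
    simp
  let S : Fin n → Set V := fun T => Set.range fun i : Fin k => (e i ((σ i).symm T) : V)
  refine ⟨Set.range S, ?_, ?_, ?_⟩
  · rintro _ ⟨T, rfl⟩
    refine ⟨fun i => ⟨e i ((σ i).symm T), ⟨⟨i, rfl⟩, (e i _).2⟩, ?_⟩, ?_⟩
    · rintro _ ⟨⟨j, rfl⟩, hj⟩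
      obtain rfl : j = i := (hcol j _).symm.trans hj
      rfl
    · rintro _ ⟨i, rfl⟩ _ ⟨j, rfl⟩ hij hadj
      rcases lt_trichotomy i j with h | rfl | h
      · exact hind T h hadj
      · exact hij rfl
      · exact hind T h hadj.symm
  · rintro _ ⟨T, rfl⟩ _ ⟨T', rfl⟩ hTT
    rw [Set.disjoint_left]
    rintro _ ⟨i, rfl⟩ ⟨j, hj⟩
    have hij : j = i := by
      have := congrArg P hj
      simpa only [hcol] using this
    subst hij
    have := (σ j).symm.injective ((e j).injective (Subtype.ext hj))
    exact hTT (by rw [this])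
  · refine Set.eq_univ_of_forall fun x => ?_
    refine Set.mem_sUnion.2 ⟨_, ⟨σ (P x) ((e (P x)).symm ⟨x, rfl⟩), rfl⟩, P x, ?_⟩
    simp

/-- In the disjoint union of `n` cliques of size `k`, an independent transversal meets each clique
at most once. This bound makes the supremum in `gMax` a maximum; the default value of `sSup` on
unbounded sets never arises. -/
theorem le_of_everyKN1GraphHasFactor {k n : ℕ} (hn : 0 < n) (h : EveryKN1GraphHasFactor k n) :
    k ≤ n := by
  rcases Nat.eq_zero_or_pos k with rfl | hk
  · exact Nat.zero_le n
  let G : SimpleGraph (Fin k × Fin n) :=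
    { Adj := fun p q => p.1 ≠ q.1 ∧ p.2 = q.2
      symm := ⟨fun _ _ h => ⟨h.1.symm, h.2.symm⟩⟩
      loopless := ⟨fun _ h => h.1 rfl⟩ }
  let P : G.Coloring (Fin k) := SimpleGraph.Coloring.mk Prod.fst fun h => h.1
  have hclass : ∀ (i : Fin k) (p : Fin k × Fin n), p ∈ P.colorClass i ↔ p.1 = i :=
    fun _ _ => Iff.rfl
  obtain ⟨F, hF⟩ := h _ G P
    { encard_part := fun i => by
        have : P.colorClass i = Set.range fun x : Fin n => (i, x) := by
          ext p
          rw [hclass]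
          constructor
          · rintro rfl
            exact ⟨p.2, rfl⟩
          · rintro ⟨x, rfl⟩
            rfl
        rw [this, ← Set.image_univ, Function.Injective.encard_image
          (fun a b hab => (Prod.ext_iff.1 hab).2), Set.encard_univ]
        simp
      matching := fun i j _ v _ w hw w' hw' h h' =>
        Prod.ext (((hclass j w).1 hw).trans ((hclass j w').1 hw').symm) (h.2.symm.trans h'.2) }
  -- A vertex to be covered guarantees that the factor is nonempty.
  have hx : ((⟨0, hk⟩, ⟨0, hn⟩) : Fin k × Fin n) ∈ ⋃₀ F := by
    rw [hF.cover]
    trivial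
  obtain ⟨S, hS, -⟩ := hx
  obtain ⟨htr, hind⟩ := hF.indepTransversal S hS
  choose s hs _ using htr
  have hinj : Function.Injective fun i => (s i).2 := by
    intro i j hij
    by_contra hne
    have h1 : (s i).1 ≠ (s j).1 := by
      rwa [(hclass _ _).1 (hs i).2, (hclass _ _).1 (hs j).2]
    exact hind (hs i).1 (hs j).1 (fun h => h1 (by rw [h])) ⟨h1, hij⟩
  simpa using Fintype.card_le_of_injective _ hinj

end Graphs

theorem lemmal :
    ∃ N : ℕ, ∀ n : ℕ, N ≤ n →
      IsGreatest {k : ℕ | EveryKN1GraphHasFactor k n} (gMax n) ∧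
        (0.562 : ℝ) * (n : ℝ) ≤ (gMax n : ℝ) := by
  obtain ⟨N, hN⟩ := exists_properLabels
  refine ⟨max N 1, fun n hn => ?_⟩
  have hmem : ⌈(0.562 : ℝ) * n⌉₊ ∈ {k : ℕ | EveryKN1GraphHasFactor k n} :=
    everyKN1GraphHasFactor_of_properLabels (hN n ((le_max_left _ _).trans hn))
  have hub : n ∈ upperBounds {k : ℕ | EveryKN1GraphHasFactor k n} := fun k hk =>
    le_of_everyKN1GraphHasFactor ((le_max_right N 1).trans hn) hk
  have hbdd : BddAbove {k : ℕ | EveryKN1GraphHasFactor k n} := ⟨n, hub⟩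
  refine ⟨⟨Nat.sSup_mem ⟨_, hmem⟩ hbdd, fun k hk => le_csSup hbdd hk⟩, ?_⟩
  exact (Nat.le_ceil _).trans (by exact_mod_cast le_csSup hbdd hmem)
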